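/- Let $\mathcal{A}$ be a finite alphabet with the discrete topology, let $\sigma$ be the left shift $(\sigma x)(n)=x(n+1)$ on $\mathcal{A}^{\mathbb{Z}}$, and let $X\subseteq\mathcal{A}^{\mathbb{Z}}$ be a subshift, i.e. a closed set with $\sigma(X)=X$. Let $P_X(n)$ be the number of words $w\in\mathcal{A}^n$ for which some $x\in X$ satisfies $x(0)x(1)\cdots x(n-1)=w$. Let $\mathrm{Hom}(X)$ be the group of homeomorphisms of $X$, let $\mathrm{Aut}(X)$ be the centralizer of $\sigma$ in $\mathrm{Hom}(X)$, and let $[\sigma]$ be the full group, i.e. the subgroup of all $\psi\in\mathrm{Hom}(X)$ such that for every $x\in X$ there is $n\in\mathbb{Z}$ with $\psi(x)=\sigma^n x$. Call $x\in X$ aperiodic if $\sigma^n x\neq x$ for all $n\geq 1$. Suppose that there is $k\in\mathbb{N}$ with $$\limsup_{n\to\infty}\frac{P_X(n)}{n}<k$$ and that the aperiodic points are dense in $X$. Then $\mathrm{Aut}(X)\cap[\sigma]$ is a normal subgroup of $\mathrm{Aut}(X)$, there is an integer $0\le d<k$ with $\mathrm{Aut}(X)\cap[\sigma]\cong\mathbb{Z}^d$,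 and the quotient group $\mathrm{Aut}(X)/(\mathrm{Aut}(X)\cap[\sigma])$ is finite. In particular, for this $d$, $\mathrm{Aut}(X)$ is virtually $\mathbb{Z}^d$, i.e. it has a subgroup of finite index isomorphic to $\mathbb{Z}^d$. -/

import Mathlib

open SymbolicDynamics.FullShift

/-- The left shift `(σ x)(n) = x(n + 1)` as a homeomorphism of the subshift `X`. -/
def shiftHomeo {A : Type*} [TopologicalSpace A] (X : Subshift A ℤ) :
    X.carrier ≃ₜ X.carrier where
  toFun x := ⟨shift 1 x.1, X.mapsTo 1 x.2⟩
  invFun x := ⟨shift (-1) x.1, X.mapsTo (-1) x.2⟩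
  left_inv x := by
    apply Subtype.ext
    funext n
    simp
  right_inv x := by
    apply Subtype.ext
    funext n
    simp
  continuous_toFun :=
    Continuous.subtype_mk ((continuous_shift (1 : ℤ)).comp continuous_subtype_val) _
  continuous_invFun :=
    Continuous.subtype_mk ((continuous_shift (-1 : ℤ)).comp continuous_subtype_val) _

/-- The one-sided cylinder set `[w]₀⁺` in `X` determined by the word `w` of length `m`. -/
def oneSidedCylinder {A : Type*} [TopologicalSpace A] (X : Subshift A ℤ) {m : ℕ}
    (w : Fin m → A) : Set X.carrier :=
  {x | ∀ i : Fin m, x.1 ((i : ℕ) : ℤ) = w i}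

/-- The words of length `m` occurring in `X`. -/
def words {A : Type*} [TopologicalSpace A] (X : Subshift A ℤ) (m : ℕ) : Set (Fin m → A) :=
  {w | (oneSidedCylinder X w).Nonempty}

/-- The complexity function `P_X(n)`, the number of words of length `n` occurring in `X`
(the alphabet is finite wherever it is used). -/
noncomputable def complexity {A : Type*} [TopologicalSpace A] (X : Subshift A ℤ) (n : ℕ) : ℕ :=
  (words X n).ncard

/-- The (two-sided) orbit of a point under the shift. -/
def shiftOrbit {A : Type*} [TopologicalSpace A] (X : Subshift A ℤ) (x : X.carrier) :
    Set X.carrier :=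
  {y | ∃ n : ℤ, y = (shiftHomeo X ^ n) x}

/-- The aperiodic points: those with `σⁿ x ≠ x` for all `n ≥ 1`. -/
def aperiodicPoints {A : Type*} [TopologicalSpace A] (X : Subshift A ℤ) : Set X.carrier :=
  {x | x ∉ Function.periodicPts (shiftHomeo X)}

/-- The automorphism group of `X`: the centralizer of the shift in the group of
homeomorphisms of `X`. -/
def shiftAut {A : Type*} [TopologicalSpace A] (X : Subshift A ℤ) :
    Subgroup (X.carrier ≃ₜ X.carrier) :=
  Subgroup.centralizer {shiftHomeo X}

/-- The full group `[σ]`: all homeomorphisms of `X` that map each point into its own orbit. -/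
def fullGroup {A : Type*} [TopologicalSpace A] (X : Subshift A ℤ) :
    Subgroup (X.carrier ≃ₜ X.carrier) where
  carrier := {ψ | ∀ x, ψ x ∈ shiftOrbit X x}
  one_mem' x := ⟨0, by simp⟩
  mul_mem' {f g} hf hg x := by
    obtain ⟨n, hn⟩ := hg x
    obtain ⟨m, hm⟩ := hf (g x)
    refine ⟨m + n, ?_⟩
    rw [zpow_add, Homeomorph.mul_apply, Homeomorph.mul_apply, ← hn, hm]
  inv_mem' {f} hf x := by
    obtain ⟨n, hn⟩ := hf (f⁻¹ x)
    refine ⟨-n, ?_⟩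
    have h1 : f (f⁻¹ x) = x := by
      rw [← Homeomorph.mul_apply, mul_inv_cancel]; rfl
    rw [h1] at hn
    conv_rhs => rw [hn]
    rw [← Homeomorph.mul_apply, ← zpow_add, neg_add_cancel, zpow_zero]
    rfl

/-- `G` is virtually `H`: it has a subgroup of finite index isomorphic to `H`. -/
def IsVirtually (G H : Type*) [Group G] [Group H] : Prop :=
  ∃ K : Subgroup G, K.FiniteIndex ∧ Nonempty (K ≃* H)

/-! Some aperiodic points are singled out dynamically: those that fail to return to a neighbourhood
of themselves in forward or in backward time, and those that are left asymptotic to another point.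
Automorphisms preserve this set `specialPoints`. Linear complexity makes it a finite union of
orbits: k non-recurrent orbits of one kind would contribute about kn words of length n, while
branching left rays are controlled by those n with P(n+1) - P(n) < k.

Every clopen neighbourhood V of an aperiodic point x meets a special orbit
(`exists_specialPoints_visiting`). If x visits V with bounded gaps, a limit of branchings inside its
orbit gives an asymptotic pair whose orbits still visit V. If the gaps are unbounded, a limit of
their endpoints is a point of V that never returns to V in one direction. Hence finitely many
special orbits are dense. Automorphisms send special orbits to special orbits, and one that fixes
each orbit of a dense finite family is a power of the shift on each orbit closure, so it lies in the
full group. Thus the quotient is finite.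

The bound d < k needs another family: finitely many aperiodic points with dense orbits, their number
M being minimal. By minimality each has a word that occurs in none of the others, and a refinement
of Morse–Hedlund gives about n words of length n containing that word. So P(n) ≥ M(n - c) and M < k.
Recording by which power of the shift an element of Aut(X) ∩ [σ] moves each of these points embeds
the group into ℤ^M. -/

/-! ### Branching words and Morse–Hedlund -/

/-- The word of length `n` of the sequence `x` starting at position `s`. -/
def window {A : Type*} (x : ℤ → A) (n : ℕ) (s : ℤ) : Fin n → A := fun i => x (s + (i : ℕ))

/-- A bi-infinite sequence without a positive period. -/
def NoPeriod {A : Type*} (x : ℤ → A) : Prop := ∀ p : ℤ, 0 < p → ∃ m, x (m + p) ≠ x m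

theorem window_eq_iff {A : Type*} {x y : ℤ → A} {n : ℕ} {s t : ℤ} :
    window x n s = window y n t ↔ ∀ i : ℤ, 0 ≤ i → i < n → x (s + i) = y (t + i) := by
  constructor
  · intro h i hi hin
    obtain ⟨j, rfl⟩ := Int.eq_ofNat_of_zero_le hi
    exact congrFun h ⟨j, by omega⟩
  · intro h
    funext i
    exact h i (by omega) (by have := i.2; omega)

/-- If every window of length n determined the next letter, it would determine the whole right ray.
Some window recurs at positions arbitrarily far to the left, and the distance of two of its
occurrences is then a period of all of x. -/
theorem NoPeriod.exists_branch {A : Type*} [Finite A] {x : ℤ → A} (hx : NoPeriod x) (n : ℕ) :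
    ∃ s t, window x n s = window x n t ∧ x (s + n) ≠ x (t + n) := by
  by_contra! hdet
  have hfwd : ∀ s t, window x n s = window x n t →
      ∀ j : ℕ, window x n (s + j) = window x n (t + j) := by
    intro s t h j
    induction j with
    | zero => simpa using h
    | succ j ih =>
      rw [window_eq_iff] at ih ⊢
      intro i hi hin
      rcases lt_or_ge (i + 1) (n : ℤ) with h1 | h1
      · have := ih (i + 1) (by omega) h1
        push_cast
        convert this using 2 <;> ring
      · have := hdet _ _ (window_eq_iff.2 ih)
        obtain rfl : i = n - 1 := by omega
        push_cast
        convert this using 2 <;> ring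
  have hfwd' : ∀ s t, window x n s = window x n t → ∀ j : ℤ, 0 ≤ j → x (s + j) = x (t + j) := by
    intro s t h j hj
    obtain ⟨j, rfl⟩ := Int.eq_ofNat_of_zero_le hj
    rcases lt_or_ge j n with h1 | h1
    · exact window_eq_iff.1 h j (by omega) (by omega)
    · have := hdet _ _ (hfwd s t h (j - n))
      convert this using 2 <;> push_cast [h1] <;> ring
  obtain ⟨v, hv⟩ := Finite.exists_infinite_fiber (fun a : ℕ => window x n (-(a : ℤ)))
  have hv' : ((fun a : ℕ => window x n (-(a : ℤ))) ⁻¹' {v}).Infinite := Set.infinite_coe_iff.1 hv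
  obtain ⟨a, ha, -⟩ := hv'.exists_gt 0
  obtain ⟨b, hb, hab⟩ := hv'.exists_gt a
  obtain ⟨m, hm⟩ := hx ((b : ℤ) - a) (by omega)
  obtain ⟨c, hc, hmc⟩ := hv'.exists_gt (m.natAbs)
  simp only [Set.mem_preimage, Set.mem_singleton_iff] at ha hb hc
  apply hm
  have h1 := hfwd' _ _ (hc.trans hb.symm) (m + c + (b - a)) (by omega)
  have h2 := hfwd' _ _ (hc.trans ha.symm) (m + c) (by omega)
  rw [show m + ((b : ℤ) - a) = -c + (m + c + (b - a)) by ring, h1, show m = -c + (m + c) by ring,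
    h2]
  congr 1
  ring

/-- The **Morse–Hedlund theorem**. -/
theorem NoPeriod.lt_ncard_range_window {A : Type*} [Finite A] {x : ℤ → A} (hx : NoPeriod x)
    (n : ℕ) : n < (Set.range (window x n)).ncard := by
  induction n with
  | zero =>
    rw [Set.ncard_pos (Set.toFinite _)]
    exact Set.range_nonempty _
  | succ n ih =>
    have himg : (fun w : Fin (n + 1) → A => Fin.init w) '' Set.range (window x (n + 1)) =
        Set.range (window x n) := by
      rw [← Set.range_comp]
      rfl
    refine Nat.lt_of_le_of_lt ih ?_
    by_contra! hle
    obtain ⟨s, t, hst, hne⟩ := hx.exists_branch n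
    rw [← himg] at hle
    have hinj := Set.injOn_of_ncard_image_eq
      (le_antisymm (Set.ncard_image_le (Set.toFinite _)) hle) (Set.toFinite _)
    have := hinj (Set.mem_range_self s) (Set.mem_range_self t) hst
    exact hne (by simpa [window] using congrFun this (Fin.last n))

/-! ### Words of non-returning sequences -/

/-- If the pattern of `y` around `0` of radius `l` never returns at positive times and `z` is not a
shift of `y`, then `y` and a left shift of `z` agree only on boundedly large windows. -/
theorem exists_radius_of_not_return {A : Type*} {y z : ℤ → A} {l : ℕ}
    (hret : ∀ n : ℤ, 0 < n → ∃ j : ℤ, |j| ≤ l ∧ y (n + j) ≠ y j) :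
    ∃ c : ℤ, ∀ a : ℤ, 0 ≤ a → (∃ m, y m ≠ z (m - a)) →
      ∃ m, -c ≤ m ∧ m < c + a ∧ y m ≠ z (m - a) := by
  -- The bound must not depend on a. An occurrence in z of the central pattern of y at some b > 0
  -- gives an occurrence in the shifted z at b + a > 0, where y has none. Otherwise take the last
  -- occurrence b ≤ 0, if there is one: agreement near 0 puts an occurrence at -a, so -a ≤ b. If -a
  -- < b, the occurrence at b moves to a + b > 0 in y; the single shift -a = b is handled by one
  -- fixed disagreement.
  by_cases hpos : ∃ b : ℤ, 0 < b ∧ ∀ j : ℤ, |j| ≤ l → z (b + j) = y j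
  · obtain ⟨b, hb, hbz⟩ := hpos
    refine ⟨b + l + 1, fun a ha _ => ?_⟩
    obtain ⟨j, hj, hne⟩ := hret (b + a) (by omega)
    rw [abs_le] at hj
    refine ⟨b + a + j, by omega, by omega, ?_⟩
    rw [show b + a + j - a = b + j by ring, hbz j (abs_le.2 hj)]
    exact hne
  · push Not at hpos
    by_cases hO : ∃ b : ℤ, ∀ j : ℤ, |j| ≤ l → z (b + j) = y j
    · obtain ⟨b, hb, hmax⟩ := Int.exists_greatest_of_bdd
        (P := fun b => ∀ j : ℤ, |j| ≤ l → z (b + j) = y j)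
        ⟨0, fun b hb => by
          by_contra! h
          obtain ⟨j, hj, hne⟩ := hpos b h
          exact hne (hb j hj)⟩ hO
      have hb0 : b ≤ 0 := by
        by_contra! h
        obtain ⟨j, hj, hne⟩ := hpos b h
        exact hne (hb j hj)
      obtain ⟨c, hc⟩ : ∃ c : ℕ, (∃ m, y m ≠ z (m + b)) → ∃ m : ℤ, |m| ≤ c ∧ y m ≠ z (m + b) := by
        by_cases h : ∃ m, y m ≠ z (m + b)
        · obtain ⟨m, hm⟩ := h
          exact ⟨m.natAbs, fun _ => ⟨m, by simp, hm⟩⟩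
        · exact ⟨0, fun h' => (h h').elim⟩
      refine ⟨l + 1 + c, fun a ha hex => ?_⟩
      by_contra! hall
      have hmem : ∀ j : ℤ, |j| ≤ l → z (-a + j) = y j := by
        intro j hj
        have hj' := abs_le.1 hj
        rw [hall j (by omega) (by omega)]
        congr 1
        ring
      rcases (hmax _ hmem).eq_or_lt with h | h
      · obtain rfl : a = -b := by omega
        simp only [sub_neg_eq_add] at hex hall
        obtain ⟨m, hm, hne⟩ := hc hex
        rw [abs_le] at hm
        exact hne (hall m (by omega) (by omega))
      · obtain ⟨j, hj, hne⟩ := hret (b + a) (by omega)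
        apply hne
        rw [← hb j hj]
        rw [abs_le] at hj
        rw [hall _ (by omega) (by omega)]
        congr 1
        ring
    · push Not at hO
      refine ⟨l + 1, fun a ha _ => ?_⟩
      obtain ⟨j, hj, hne⟩ := hO (-a)
      rw [abs_le] at hj
      refine ⟨j, by omega, by omega, ?_⟩
      rw [show j - a = -a + j by ring]
      exact hne.symm

/-- The windows of each sequence that contain [-C, C) are pairwise distinct, also across sequences:
two equal ones would make y i agree with a right shift of y j on a range excluded by
`exists_radius_of_not_return`. -/
theorem mul_sub_le_ncard_of_not_return {A : Type*} [Finite A] {M : ℕ} (y : Fin M → ℤ → A) {l : ℕ}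
    (hret : ∀ i, ∀ n : ℤ, 0 < n → ∃ j : ℤ, |j| ≤ l ∧ y i (n + j) ≠ y i j)
    (horb : ∀ i j, i ≠ j → ∀ a : ℤ, ∃ m, y i m ≠ y j (m - a)) :
    ∃ c : ℕ, ∀ n : ℕ, M * (n - c) ≤ (⋃ i, Set.range (window (y i) n)).ncard := by
  choose c hc using fun i j : Fin M => exists_radius_of_not_return (z := y j) (hret i)
  obtain ⟨C, hC⟩ : ∃ C : ℕ, ∀ i j, c i j ≤ C := by
    obtain ⟨C, hC⟩ := (Set.finite_range fun p : Fin M × Fin M => c p.1 p.2).bddAbove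
    exact ⟨C.toNat, fun i j => (hC ⟨(i, j), rfl⟩).trans (Int.self_le_toNat C)⟩
  refine ⟨2 * C, fun n => ?_⟩
  let f : Fin M × Fin (n - 2 * C) → (Fin n → A) := fun p => window (y p.1) n (-(C + (p.2 : ℕ) : ℤ))
  have key : ∀ i j : Fin M, ∀ s t : Fin (n - 2 * C), s ≤ t → f (i, s) = f (j, t) →
      (i, s) = (j, t) := by
    intro i j s t hst heq
    by_contra hne
    have hs := s.2
    have ht := t.2
    have hst' : (s : ℕ) ≤ t := hst
    obtain ⟨m, h1, h2, h3⟩ := hc i j ((t : ℤ) - s) (by omega) (by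
      by_cases hij : i = j
      · subst hij
        have hlt : (s : ℕ) < t := by
          rcases hst.eq_or_lt with h | h
          · exact absurd (by rw [h]) hne
          · exact h
        obtain ⟨m, -, hm⟩ := hret i ((t : ℤ) - s) (by omega)
        exact ⟨(t : ℤ) - s + m, by simpa using hm⟩
      · exact horb i j hij _)
    have := hC i j
    apply h3
    have := window_eq_iff.1 heq (m + C + s) (by omega) (by omega)
    convert this using 2 <;> simp only <;> ring
  have hinj : Function.Injective f := by
    rintro ⟨i, s⟩ ⟨j, t⟩ h
    rcases le_total s t with hst | hst
    · exact key i j s t hst h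
    · exact (key j i t s hst h.symm).symm
  calc M * (n - 2 * C) = (Set.range f).ncard := by
        rw [← Set.image_univ, Set.ncard_image_of_injective _ hinj, Set.ncard_univ]
        simp
    _ ≤ _ := Set.ncard_le_ncard (by
        rintro _ ⟨⟨i, s⟩, rfl⟩
        exact Set.mem_iUnion.2 ⟨i, Set.mem_range_self _⟩) (Set.toFinite _)

theorem range_window_neg {A : Type*} (x : ℤ → A) (n : ℕ) :
    Set.range (window (fun m => x (-m)) n) =
      (fun w : Fin n → A => w ∘ Fin.rev) '' Set.range (window x n) := by
  have h : ∀ s, window (fun m => x (-m)) n s = window x n (-(s + n - 1)) ∘ Fin.rev := by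
    intro s
    funext i
    have := i.2
    simp only [window, Function.comp, Fin.val_rev]
    congr 1
    omega
  ext w
  constructor
  · rintro ⟨s, rfl⟩
    exact ⟨_, Set.mem_range_self _, (h s).symm⟩
  · rintro ⟨_, ⟨s, rfl⟩, rfl⟩
    refine ⟨-s - n + 1, ?_⟩
    rw [h]
    congr 2
    ring

theorem mul_sub_le_ncard_of_not_return_neg {A : Type*} [Finite A] {M : ℕ} (y : Fin M → ℤ → A)
    {l : ℕ} (hret : ∀ i, ∀ n : ℤ, n < 0 → ∃ j : ℤ, |j| ≤ l ∧ y i (n + j) ≠ y i j)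
    (horb : ∀ i j, i ≠ j → ∀ a : ℤ, ∃ m, y i m ≠ y j (m - a)) :
    ∃ c : ℕ, ∀ n : ℕ, M * (n - c) ≤ (⋃ i, Set.range (window (y i) n)).ncard := by
  obtain ⟨c, hc⟩ := mul_sub_le_ncard_of_not_return (fun i m => y i (-m)) (l := l)
    (fun i n hn => by
      obtain ⟨j, hj, hne⟩ := hret i (-n) (by omega)
      refine ⟨-j, by simpa using hj, ?_⟩
      simpa [add_comm] using hne)
    (fun i j hij a => by
      obtain ⟨m, hm⟩ := horb i j hij (-a)
      refine ⟨-m, ?_⟩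
      convert hm using 2 <;> ring_nf)
  refine ⟨c, fun n => (hc n).trans ?_⟩
  simp only [range_window_neg, ← Set.image_iUnion]
  exact Set.ncard_image_le (Set.toFinite _)

/-! ### Words containing a prescribed word -/

/-- Next to a window that avoids `O ∋ 0` there is an element of `O` followed, or preceded, by a gap of
the length of this window. -/
theorem Int.exists_gap {O : Set ℤ} (h0 : (0 : ℤ) ∈ O) {s e : ℤ}
    (h : ∀ t, s ≤ t → t < e → t ∉ O) :
    ∃ b ∈ O, (∀ d : ℤ, 0 < d → d < e - s → b + d ∉ O) ∨
      (∀ d : ℤ, 0 < d → d < e - s → b - d ∉ O) := by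
  rcases lt_or_ge 0 s with hs | hs
  · obtain ⟨b, hb, hmax⟩ := Int.exists_greatest_of_bdd (P := fun b => b < s ∧ b ∈ O)
      ⟨s, fun b hb => hb.1.le⟩ ⟨0, hs, h0⟩
    refine ⟨b, hb.2, Or.inl fun d hd hdn hmem => ?_⟩
    rcases lt_or_ge (b + d) s with h1 | h1
    · have := hmax _ ⟨h1, hmem⟩
      omega
    · exact h _ h1 (by omega) hmem
  · rcases lt_or_ge 0 e with he | he
    · exact absurd h0 (h 0 hs he)
    · obtain ⟨b, hb, hmin⟩ := Int.exists_least_of_bdd (P := fun b => e ≤ b ∧ b ∈ O)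
        ⟨e, fun b hb => hb.1⟩ ⟨0, he, h0⟩
      refine ⟨b, hb.2, Or.inr fun d hd hdn hmem => ?_⟩
      rcases lt_or_ge (b - d) e with h1 | h1
      · exact h _ (by omega) h1 hmem
      · have := hmin _ ⟨h1, hmem⟩
        omega

/-- A sequence without period has many words of length `n` in which a given word of it occurs. -/
theorem NoPeriod.sub_le_ncard_windows {A : Type*} [Finite A] {x : ℤ → A} (hx : NoPeriod x)
    (l n : ℕ) :
    n - 2 * l ≤ ((window x n) '' {s | ∃ t : ℤ, s + l ≤ t ∧ t + l < s + n ∧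
      ∀ j : ℤ, |j| ≤ l → x (t + j) = x j}).ncard := by
  set O : Set ℤ := {t | ∀ j : ℤ, |j| ≤ l → x (t + j) = x j} with hO
  have h0 : (0 : ℤ) ∈ O := by
    intro j _
    simp
  by_cases hall : ∀ s : ℤ, ∃ t : ℤ, s + l ≤ t ∧ t + l < s + n ∧ t ∈ O
  · have : {s : ℤ | ∃ t : ℤ, s + l ≤ t ∧ t + l < s + n ∧ ∀ j : ℤ, |j| ≤ l → x (t + j) = x j} =
        Set.univ := Set.eq_univ_of_forall hall
    rw [this, Set.image_univ]
    have := hx.lt_ncard_range_window n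
    omega
  -- Some long window misses the central word, so an occurrence b borders a gap. The n - 2l windows
  -- around b are distinct, since equality of two of them would produce, on either side of b, an
  -- occurrence at distance less than n - 2l.
  · push Not at hall
    obtain ⟨s, hs⟩ := hall
    obtain ⟨b, hb, hgap⟩ := Int.exists_gap (s := s + l) (e := s + n - l) h0 fun t h1 h2 =>
      hs t h1 (by omega)
    let f : Fin (n - 2 * l) → (Fin n → A) := fun t => window x n (b - l - (t : ℕ))
    have shift_mem : ∀ s t : Fin (n - 2 * l), f s = f t → b - s + t ∈ O := by
      intro s t h j hj
      have hs := s.2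
      have ht := t.2
      rw [← hb j hj]
      rw [abs_le] at hj
      have := window_eq_iff.1 h (l + t + j) (by omega) (by omega)
      convert this using 2 <;> ring
    have hinj : Function.Injective f := by
      intro s t h
      by_contra hne
      wlog hlt : s < t generalizing s t with H
      · exact H h.symm (Ne.symm hne) (lt_of_le_of_ne (not_lt.1 hlt) (Ne.symm hne))
      have hs := s.2
      have ht := t.2
      have hlt' : (s : ℕ) < t := hlt
      rcases hgap with hg | hg
      · refine hg ((t : ℤ) - s) (by omega) (by omega) ?_
        convert shift_mem s t h using 1
        ring
      · refine hg ((t : ℤ) - s) (by omega) (by omega) ?_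
        convert shift_mem t s h.symm using 1
        ring
    calc n - 2 * l = (Set.range f).ncard := by
          rw [← Set.image_univ, Set.ncard_image_of_injective _ hinj, Set.ncard_univ]
          simp
      _ ≤ _ := Set.ncard_le_ncard (by
          rintro _ ⟨t, rfl⟩
          have ht := t.2
          exact ⟨_, ⟨b, by omega, by omega, hb⟩, rfl⟩) (Set.toFinite _)

/-- Sequences without period, each of which has a word that occurs in none of the others. -/
theorem mul_sub_le_ncard_of_independent {A : Type*} [Finite A] {M : ℕ} (x : Fin M → ℤ → A)
    (hx : ∀ i, NoPeriod (x i)) {l : ℕ}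
    (hind : ∀ i j, i ≠ j → ∀ t : ℤ, ∃ m : ℤ, |m| ≤ l ∧ x j (t + m) ≠ x i m) :
    ∃ c : ℕ, ∀ n : ℕ, M * (n - c) ≤ (⋃ i, Set.range (window (x i) n)).ncard := by
  refine ⟨2 * l, fun n => ?_⟩
  set V : Fin M → Set (Fin n → A) := fun i => (window (x i) n) '' {s | ∃ t : ℤ, s + l ≤ t ∧
    t + l < s + n ∧ ∀ j : ℤ, |j| ≤ l → x i (t + j) = x i j} with hV
  have hdisj : Pairwise (Function.onFun Disjoint V) := by
    intro i j hij
    rw [Function.onFun, Set.disjoint_left]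
    rintro _ ⟨s, ⟨t, h1, h2, h3⟩, rfl⟩ ⟨s', -, heq⟩
    obtain ⟨m, hm, hne⟩ := hind i j hij (s' + t - s)
    apply hne
    rw [← h3 m hm]
    rw [abs_le] at hm
    have := window_eq_iff.1 heq (t - s + m) (by omega) (by omega)
    convert this using 2 <;> ring
  calc M * (n - 2 * l) = ∑ _i : Fin M, (n - 2 * l) := by simp
    _ ≤ ∑ i, (V i).ncard := Finset.sum_le_sum fun i _ => (hx i).sub_le_ncard_windows l n
    _ = (⋃ i, V i).ncard := by
      rw [← finsum_eq_sum_of_fintype, Set.ncard_iUnion_of_finite (fun _ => Set.toFinite _) hdisj]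
    _ ≤ _ := Set.ncard_le_ncard (Set.iUnion_mono fun i => Set.image_subset_range _ _)
      (Set.toFinite _)

/-- Elements that share their image with another element are at most twice as many as the defect
of injectivity. -/
theorem ncard_not_unique_le {α β : Type*} [Finite α] (f : α → β) (S : Set α) :
    {a ∈ S | ∃ b ∈ S, b ≠ a ∧ f b = f a}.ncard ≤ 2 * (S.ncard - (f '' S).ncard) := by
  classical
  have hS := S.toFinite
  obtain ⟨s, rfl⟩ := hS.exists_finset_coe
  have hN : {a ∈ (s : Set α) | ∃ b ∈ (s : Set α), b ≠ a ∧ f b = f a} =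
      ((s.filter fun a => ∃ b ∈ s, b ≠ a ∧ f b = f a : Finset α) : Set α) := by
    ext a
    simp
  rw [hN, ← Finset.coe_image, Set.ncard_coe_finset, Set.ncard_coe_finset, Set.ncard_coe_finset]
  have hmaps : ∀ a ∈ s.filter (fun a => ∃ b ∈ s, b ≠ a ∧ f b = f a), f a ∈ s.image f := fun a ha =>
    Finset.mem_image_of_mem f (Finset.mem_filter.1 ha).1
  -- A fibre with one element contributes 0, and a fibre of size r ≥ 2 contributes at most r ≤ 2(r -
  -- 1). The summand 2 on the left avoids truncated subtraction.
  have key : ∑ b ∈ s.image f, (((s.filter fun a => ∃ b ∈ s, b ≠ a ∧ f b = f a).filter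
      fun a => f a = b).card + 2) ≤ ∑ b ∈ s.image f, 2 * (s.filter fun a => f a = b).card := by
    refine Finset.sum_le_sum fun b hb => ?_
    obtain ⟨a, ha, rfl⟩ := Finset.mem_image.1 hb
    have hpos : 0 < (s.filter fun c => f c = f a).card :=
      Finset.card_pos.2 ⟨a, Finset.mem_filter.2 ⟨ha, rfl⟩⟩
    rcases Nat.eq_or_lt_of_le hpos with h1 | h1
    · have : ((s.filter fun a => ∃ b ∈ s, b ≠ a ∧ f b = f a).filter fun c => f c = f a) = ∅ := by
        rw [Finset.filter_eq_empty_iff]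
        intro c hc hca
        obtain ⟨hcs, d, hds, hdc, hd⟩ := Finset.mem_filter.1 hc
        exact hdc (Finset.card_le_one.1 h1.symm.le d
          (Finset.mem_filter.2 ⟨hds, hd.trans hca⟩) c (Finset.mem_filter.2 ⟨hcs, hca⟩))
      rw [this, Finset.card_empty]
      omega
    · have : ((s.filter fun a => ∃ b ∈ s, b ≠ a ∧ f b = f a).filter fun c => f c = f a).card ≤
          (s.filter fun c => f c = f a).card :=
        Finset.card_le_card (Finset.filter_subset_filter _ (Finset.filter_subset _ _))
      omega
  rw [Finset.sum_add_distrib, ← Finset.card_eq_sum_card_fiberwise hmaps, ← Finset.mul_sum,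
    ← Finset.card_eq_sum_card_image] at key
  simp only [Finset.sum_const, smul_eq_mul] at key
  omega

/-! ### Orbits, complexity and topology of the subshift -/

theorem shiftHomeo_pow_apply {A : Type*} [TopologicalSpace A] (X : Subshift A ℤ) (n : ℕ)
    (x : X.carrier) (m : ℤ) : ((shiftHomeo X ^ n) x).1 m = x.1 (n + m) := by
  induction n generalizing x with
  | zero => simp
  | succ n ih =>
    rw [pow_succ, Homeomorph.mul_apply, ih]
    refine congrArg x.1 (?_ : 1 + (n + m) = ((n + 1 : ℕ) : ℤ) + m)
    push_cast
    ring

theorem shiftHomeo_zpow_apply {A : Type*} [TopologicalSpace A] (X : Subshift A ℤ) (n : ℤ)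
    (x : X.carrier) (m : ℤ) : ((shiftHomeo X ^ n) x).1 m = x.1 (n + m) := by
  obtain ⟨a, rfl | rfl⟩ := n.eq_nat_or_neg
  · rw [zpow_natCast, shiftHomeo_pow_apply]
  · have h := shiftHomeo_pow_apply X a ((shiftHomeo X ^ (-(a : ℤ))) x) (-a + m)
    rw [← zpow_natCast, ← Homeomorph.mul_apply, ← zpow_add, add_neg_cancel, zpow_zero] at h
    rw [show ((a : ℤ) + (-a + m)) = m by ring] at h
    exact h.symm

theorem mem_aperiodicPoints_iff {A : Type*} [TopologicalSpace A] {X : Subshift A ℤ}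
    {x : X.carrier} : x ∈ aperiodicPoints X ↔ NoPeriod x.1 := by
  have hit : ∀ n : ℕ, (shiftHomeo X)^[n] x = (shiftHomeo X ^ n) x := by
    intro n
    induction n with
    | zero => simp
    | succ n ih => rw [Function.iterate_succ_apply', ih, pow_succ', Homeomorph.mul_apply]
  change ¬ (∃ n > 0, (shiftHomeo X)^[n] x = x) ↔ _
  simp only [hit]
  constructor
  · intro h p hp
    by_contra! hper
    refine h ⟨p.toNat, by omega, ?_⟩
    apply Subtype.ext
    funext m
    rw [shiftHomeo_pow_apply, ← hper m, Int.toNat_of_nonneg hp.le, add_comm]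
  · rintro h ⟨n, hn, hx⟩
    obtain ⟨m, hm⟩ := h n (by omega)
    apply hm
    conv_rhs => rw [← hx]
    rw [shiftHomeo_pow_apply, add_comm]

theorem shiftOrbit_eq_of_mem {A : Type*} [TopologicalSpace A] {X : Subshift A ℤ}
    {x y : X.carrier} (h : y ∈ shiftOrbit X x) : shiftOrbit X y = shiftOrbit X x := by
  obtain ⟨n, rfl⟩ := h
  ext z
  constructor
  · rintro ⟨m, rfl⟩
    exact ⟨m + n, by rw [zpow_add, Homeomorph.mul_apply]⟩
  · rintro ⟨m, rfl⟩
    exact ⟨m - n, by rw [← Homeomorph.mul_apply, ← zpow_add, sub_add_cancel]⟩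

theorem mem_shiftOrbit_self {A : Type*} [TopologicalSpace A] {X : Subshift A ℤ}
    (x : X.carrier) : x ∈ shiftOrbit X x := ⟨0, by simp⟩

theorem exists_ne_of_shiftOrbit_ne {A : Type*} [TopologicalSpace A] {X : Subshift A ℤ}
    {x y : X.carrier} (h : shiftOrbit X x ≠ shiftOrbit X y) (a : ℤ) :
    ∃ m, x.1 m ≠ y.1 (m - a) := by
  by_contra! hall
  apply h
  apply shiftOrbit_eq_of_mem
  refine ⟨-a, Subtype.ext (funext fun m => ?_)⟩
  rw [shiftHomeo_zpow_apply, hall]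
  exact congrArg y.1 (by ring)

theorem range_window_subset_words {A : Type*} [TopologicalSpace A] (X : Subshift A ℤ)
    (x : X.carrier) (n : ℕ) : Set.range (window x.1 n) ⊆ words X n := by
  rintro _ ⟨s, rfl⟩
  exact ⟨(shiftHomeo X ^ s) x, fun i => by rw [shiftHomeo_zpow_apply]; rfl⟩

theorem image_init_words {A : Type*} [TopologicalSpace A] (X : Subshift A ℤ) (n : ℕ) :
    (fun w : Fin (n + 1) → A => Fin.init w) '' words X (n + 1) = words X n := by
  ext w
  constructor
  · rintro ⟨v, ⟨x, hx⟩, rfl⟩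
    exact ⟨x, fun i => hx i.castSucc⟩
  · rintro ⟨x, hx⟩
    exact ⟨window x.1 (n + 1) 0, range_window_subset_words X x _ ⟨0, rfl⟩, funext fun i => by
      simp [Fin.init, window, ← hx i]⟩

theorem lt_of_mul_sub_le_complexity {A : Type*} [TopologicalSpace A] {X : Subshift A ℤ} {k : ℕ}
    (hk : Filter.limsup (fun n : ℕ => (complexity X n : ENNReal) / (n : ENNReal)) Filter.atTop
      < (k : ENNReal)) {M c : ℕ}
    (h : ∀ᶠ n in Filter.atTop, M * (n - c) ≤ complexity X n) : M < k := by
  by_contra! hkM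
  obtain ⟨r, hr, hrk⟩ := exists_between hk
  lift r to NNReal using (hrk.trans_le le_top).ne
  have hrk' : (r : ℝ) < k := by exact_mod_cast hrk
  obtain ⟨N, hN⟩ := exists_nat_gt ((k * c : ℝ) / (k - r))
  obtain ⟨n, ⟨h1, h2⟩, h3⟩ := ((h.and (Filter.eventually_lt_of_limsup_lt hr)).and
    (Filter.eventually_ge_atTop (N + c + 1))).exists
  rw [ENNReal.div_lt_iff (Or.inl (by simp; omega)) (Or.inl (by simp))] at h2
  have h2' : (complexity X n : ℝ) < r * n := by exact_mod_cast h2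
  have h1' : ((M * (n - c) : ℕ) : ℝ) ≤ complexity X n := by exact_mod_cast h1
  have h4 : ((k * (n - c) : ℕ) : ℝ) ≤ (M * (n - c) : ℕ) := by
    exact_mod_cast Nat.mul_le_mul_right _ hkM
  rw [Nat.cast_mul, Nat.cast_sub (by omega)] at h4
  rw [div_lt_iff₀ (by linarith)] at hN
  have h5 : (N : ℝ) ≤ n := by exact_mod_cast (by omega : N ≤ n)
  nlinarith

/-- Increments of at least k from N on would add up to P(n) ≥ k(n - N). -/
theorem exists_complexity_succ_lt {A : Type*} [TopologicalSpace A] {X : Subshift A ℤ} {k : ℕ}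
    (hk : Filter.limsup (fun n : ℕ => (complexity X n : ENNReal) / (n : ENNReal)) Filter.atTop
      < (k : ENNReal)) (N : ℕ) : ∃ n ≥ N, complexity X (n + 1) < complexity X n + k := by
  by_contra! hall
  refine lt_irrefl k (lt_of_mul_sub_le_complexity hk (c := N) ?_)
  filter_upwards [Filter.eventually_ge_atTop N] with n hn
  induction n, hn using Nat.le_induction with
  | base => simp
  | succ n hn ih =>
    have := hall n hn
    rw [Nat.succ_sub hn, Nat.mul_succ]
    omega

theorem lt_of_family {A : Type*} [Finite A] [TopologicalSpace A] {X : Subshift A ℤ} {k : ℕ}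
    (hk : Filter.limsup (fun n : ℕ => (complexity X n : ENNReal) / (n : ENNReal)) Filter.atTop
      < (k : ENNReal)) {M : ℕ} (y : Fin M → X.carrier)
    (h : ∃ c : ℕ, ∀ n : ℕ, M * (n - c) ≤ (⋃ i, Set.range (window (y i).1 n)).ncard) : M < k := by
  obtain ⟨c, hc⟩ := h
  refine lt_of_mul_sub_le_complexity hk (c := c) (Filter.Eventually.of_forall fun n => ?_)
  exact (hc n).trans (Set.ncard_le_ncard
    (Set.iUnion_subset fun i => range_window_subset_words X (y i) n) (Set.toFinite _))

theorem exists_radius_of_mem_nhds {A : Type*} [TopologicalSpace A] {X : Subshift A ℤ}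
    {x : X.carrier} {U : Set X.carrier} (hU : U ∈ nhds x) :
    ∃ l : ℕ, ∀ y : X.carrier, (∀ m : ℤ, |m| ≤ l → y.1 m = x.1 m) → y ∈ U := by
  rw [nhds_subtype, Filter.mem_comap] at hU
  obtain ⟨V, hV, hVU⟩ := hU
  rw [nhds_pi, Filter.mem_pi] at hV
  obtain ⟨I, hI, t, ht, htV⟩ := hV
  obtain ⟨l, hl⟩ := (hI.image Int.natAbs).bddAbove
  refine ⟨l, fun y hy => hVU (htV fun i hi => ?_)⟩
  have : i.natAbs ≤ l := hl ⟨i, hi, rfl⟩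
  rw [hy i (by rw [Int.abs_eq_natAbs]; exact_mod_cast this)]
  exact mem_of_mem_nhds (ht i)

theorem continuous_coordinate {A : Type*} [TopologicalSpace A] (X : Subshift A ℤ) (m : ℤ) :
    Continuous fun y : X.carrier => y.1 m :=
  (continuous_apply m).comp continuous_subtype_val

theorem isClopen_coordinate_eq {A : Type*} [TopologicalSpace A] [DiscreteTopology A]
    (X : Subshift A ℤ) (m : ℤ) (a : A) : IsClopen {y : X.carrier | y.1 m = a} :=
  (isClopen_discrete {a}).preimage (continuous_coordinate X m)

theorem isClopen_radius {A : Type*} [TopologicalSpace A] [DiscreteTopology A]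
    {X : Subshift A ℤ} (x : X.carrier) (l : ℕ) :
    IsClopen {y : X.carrier | ∀ m : ℤ, |m| ≤ l → y.1 m = x.1 m} := by
  have : {y : X.carrier | ∀ m : ℤ, |m| ≤ l → y.1 m = x.1 m} =
      ⋂ m ∈ Set.Icc (-l : ℤ) l, {y : X.carrier | y.1 m = x.1 m} := by
    ext y
    simp [abs_le]
  rw [this]
  exact (Set.finite_Icc _ _).isClopen_biInter fun m _ => isClopen_coordinate_eq X m _

instance subshift_compactSpace {A : Type*} [Finite A] [TopologicalSpace A] (X : Subshift A ℤ) :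
    CompactSpace X.carrier :=
  isCompact_iff_compactSpace.1 X.isClosed.isCompact

theorem exists_forall_mem_of_antitone {Z : Type*} [TopologicalSpace Z] [CompactSpace Z]
    {K : ℕ → Set Z} (hK : Antitone K) (hclosed : ∀ n, IsClosed (K n))
    (hne : ∀ n, (K n).Nonempty) : ∃ z, ∀ n, z ∈ K n := by
  obtain ⟨z, hz⟩ := IsCompact.nonempty_iInter_of_sequence_nonempty_isCompact_isClosed K
    (fun n => hK n.le_succ) hne (hclosed 0).isCompact hclosed
  exact ⟨z, Set.mem_iInter.1 hz⟩

/-! ### Automorphisms -/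

theorem shiftAut_apply_zpow {A : Type*} [TopologicalSpace A] {X : Subshift A ℤ}
    {φ : X.carrier ≃ₜ X.carrier} (hφ : φ ∈ shiftAut X) (n : ℤ) (x : X.carrier) :
    φ ((shiftHomeo X ^ n) x) = (shiftHomeo X ^ n) (φ x) := by
  have h : Commute φ (shiftHomeo X) := (Subgroup.mem_centralizer_singleton_iff.1 hφ)
  have := (h.zpow_right n).eq
  exact DFunLike.congr_fun this x

theorem shiftOrbit_image {A : Type*} [TopologicalSpace A] {X : Subshift A ℤ}
    {φ : X.carrier ≃ₜ X.carrier} (hφ : φ ∈ shiftAut X) {x y : X.carrier}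
    (h : x ∈ shiftOrbit X y) : φ x ∈ shiftOrbit X (φ y) := by
  obtain ⟨n, rfl⟩ := h
  exact ⟨n, shiftAut_apply_zpow hφ n y⟩

theorem aperiodicPoints_image {A : Type*} [TopologicalSpace A] {X : Subshift A ℤ}
    {φ : X.carrier ≃ₜ X.carrier} (hφ : φ ∈ shiftAut X) {x : X.carrier}
    (h : x ∈ aperiodicPoints X) : φ x ∈ aperiodicPoints X := by
  rintro ⟨n, hn, hper⟩
  refine h ⟨n, hn, ?_⟩
  have hc : Function.Semiconj φ (shiftHomeo X) (shiftHomeo X) := fun z => by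
    simpa using shiftAut_apply_zpow hφ 1 z
  apply φ.injective
  rw [hc.iterate_right n x]
  exact hper

/-- An automorphism of a subshift is a block code. -/
theorem exists_block_radius {A : Type*} [Finite A] [TopologicalSpace A] [DiscreteTopology A]
    {X : Subshift A ℤ} {φ : X.carrier ≃ₜ X.carrier} (hφ : φ ∈ shiftAut X) :
    ∃ R : ℕ, ∀ (x y : X.carrier) (t : ℤ), (∀ m : ℤ, |m| ≤ R → x.1 (t + m) = y.1 (t + m)) →
      (φ x).1 t = (φ y).1 t := by
  suffices h : ∃ R : ℕ, ∀ x y : X.carrier, (∀ m : ℤ, |m| ≤ R → x.1 m = y.1 m) →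
      (φ x).1 0 = (φ y).1 0 by
    obtain ⟨R, hR⟩ := h
    refine ⟨R, fun x y t hxy => ?_⟩
    have := hR ((shiftHomeo X ^ t) x) ((shiftHomeo X ^ t) y) (fun m hm => by
      simpa only [shiftHomeo_zpow_apply] using hxy m hm)
    simpa only [shiftAut_apply_zpow hφ, shiftHomeo_zpow_apply, add_zero] using this
  by_contra! hall
  have hcont := continuous_coordinate X
  -- By compactness, counterexamples for all radii accumulate at a pair with x = y whose images
  -- differ at 0.
  obtain ⟨⟨x, y⟩, hxy⟩ := exists_forall_mem_of_antitone
    (K := fun R : ℕ => {p : X.carrier × X.carrier |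
      (∀ m : ℤ, |m| ≤ R → p.1.1 m = p.2.1 m) ∧ (φ p.1).1 0 ≠ (φ p.2).1 0})
    (fun R S hRS p hp => ⟨fun m hm => hp.1 m (hm.trans (by exact_mod_cast hRS)), hp.2⟩)
    (fun R => by
      refine IsClosed.inter (s₁ := {p : X.carrier × X.carrier | ∀ m : ℤ, |m| ≤ R →
        p.1.1 m = p.2.1 m}) ?_ ?_
      · simp only [Set.ofPred_forall]
        exact isClosed_iInter fun m => isClosed_iInter fun _ =>
          isClosed_eq ((hcont m).comp continuous_fst) ((hcont m).comp continuous_snd)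
      · exact (isClosed_discrete {q : A × A | q.1 ≠ q.2}).preimage
          (((hcont 0).comp (φ.continuous.comp continuous_fst)).prodMk
            ((hcont 0).comp (φ.continuous.comp continuous_snd))))
    (fun R => by
      obtain ⟨x, y, h1, h2⟩ := hall R
      exact ⟨(x, y), h1, h2⟩)
  have : x = y := Subtype.ext (funext fun m => (hxy m.natAbs).1 m (by simp))
  exact (hxy 0).2 (by rw [this])

/-! ### Special points and their invariance -/

/-- The points that do not return to each of their neighbourhoods along the filter `F` of times. -/
def nonRecurrentPoints {A : Type*} [TopologicalSpace A] (X : Subshift A ℤ) (F : Filter ℤ) :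
    Set X.carrier :=
  {y | ¬ MapClusterPt y F fun n : ℤ => (shiftHomeo X ^ n) y}

/-- `y` agrees with another point of `X` strictly before time `t` but not at time `t`. -/
def BranchesAt {A : Type*} [TopologicalSpace A] {X : Subshift A ℤ} (y : X.carrier) (t : ℤ) : Prop :=
  ∃ z : X.carrier, (∀ m < t, z.1 m = y.1 m) ∧ z.1 t ≠ y.1 t

/-- The aperiodic points that are left asymptotic to another point. -/
def asymptoticPoints {A : Type*} [TopologicalSpace A] (X : Subshift A ℤ) : Set X.carrier :=
  {y | y ∈ aperiodicPoints X ∧ ∃ t, BranchesAt y t}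

theorem nonRecurrentPoints_image {A : Type*} [TopologicalSpace A] {X : Subshift A ℤ}
    {F : Filter ℤ} {φ : X.carrier ≃ₜ X.carrier} (hφ : φ ∈ shiftAut X) {y : X.carrier}
    (h : y ∈ nonRecurrentPoints X F) : φ y ∈ nonRecurrentPoints X F := by
  intro hc
  apply h
  have := hc.continuousAt_comp (φ.symm.continuous.continuousAt (x := φ y))
  rw [Homeomorph.symm_apply_apply] at this
  convert this using 2 with n
  rw [Function.comp_apply, ← shiftAut_apply_zpow hφ, Homeomorph.symm_apply_apply]

/-- A block code of radius R preserves agreement before t up to time t - R, and injectivity keeps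
the images distinct; their first disagreement is a branching time. -/
theorem asymptoticPoints_image {A : Type*} [Finite A] [TopologicalSpace A] [DiscreteTopology A]
    {X : Subshift A ℤ} {φ : X.carrier ≃ₜ X.carrier} (hφ : φ ∈ shiftAut X) {y : X.carrier}
    (h : y ∈ asymptoticPoints X) : φ y ∈ asymptoticPoints X := by
  obtain ⟨hy, t, z, hz, hne⟩ := h
  refine ⟨aperiodicPoints_image hφ hy, ?_⟩
  obtain ⟨R, hR⟩ := exists_block_radius hφ
  have hex : ∃ m, (φ z).1 m ≠ (φ y).1 m := by
    by_contra! hall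
    exact hne (by rw [φ.injective (Subtype.ext (funext hall))])
  obtain ⟨s, hs, hmin⟩ := Int.exists_least_of_bdd (P := fun m => (φ z).1 m ≠ (φ y).1 m)
    ⟨t - R, fun m hm => by
      by_contra! hlt
      refine hm (hR z y m fun j hj => hz _ ?_)
      have := (abs_le.1 hj).2
      omega⟩ hex
  refine ⟨s, φ z, fun m hm => ?_, hs⟩
  by_contra hm'
  have := hmin m hm'
  omega

theorem nonRecurrentPoints_subset_aperiodicPoints {A : Type*} [TopologicalSpace A]
    (X : Subshift A ℤ) {F : Filter ℤ} (hF : F = Filter.atTop ∨ F = Filter.atBot) :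
    nonRecurrentPoints X F ⊆ aperiodicPoints X := by
  intro y hy
  rw [mem_aperiodicPoints_iff]
  intro p hp
  by_contra! hper
  have hmul : ∀ n : ℤ, (shiftHomeo X ^ (n * p)) y = y := by
    have h1 : (shiftHomeo X ^ p) y = y := by
      apply Subtype.ext
      funext m
      rw [shiftHomeo_zpow_apply, ← hper m, add_comm]
    have h2 : ∀ n : ℕ, (shiftHomeo X ^ (n * p : ℤ)) y = y := by
      intro n
      induction n with
      | zero => simp
      | succ n ih => rw [Nat.cast_succ, add_mul, one_mul, zpow_add, Homeomorph.mul_apply, h1, ih]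
    intro n
    obtain ⟨a, rfl | rfl⟩ := n.eq_nat_or_neg
    · exact h2 a
    · conv_lhs => rw [← h2 a]
      rw [← Homeomorph.mul_apply, ← zpow_add, neg_mul, neg_add_cancel, zpow_zero]
      rfl
  apply hy
  rw [mapClusterPt_iff_frequently]
  intro U hU
  have hyU := mem_of_mem_nhds hU
  rcases hF with rfl | rfl
  · rw [Filter.frequently_atTop]
    exact fun a => ⟨|a| * p, by nlinarith [le_abs_self a, abs_nonneg a], by rwa [hmul]⟩
  · rw [Filter.frequently_atBot]
    exact fun a => ⟨(-|a|) * p, by nlinarith [neg_abs_le a, abs_nonneg a], by rwa [hmul]⟩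

/-! ### Finitely many non-recurrent orbits -/

theorem NoPeriod.exists_radius {A : Type*} {y : ℤ → A} (hy : NoPeriod y) (N : ℕ) :
    ∃ l : ℕ, ∀ n : ℤ, n ≠ 0 → |n| ≤ N → ∃ j : ℤ, |j| ≤ l ∧ y (n + j) ≠ y j := by
  have h : ∀ n : ℤ, ∃ l : ℕ, n ≠ 0 → ∃ j : ℤ, |j| ≤ l ∧ y (n + j) ≠ y j := by
    intro n
    rcases lt_trichotomy n 0 with hn | rfl | hn
    · obtain ⟨m, hm⟩ := hy (-n) (by omega)
      refine ⟨(m - n).natAbs, fun _ => ⟨m - n, by simp, ?_⟩⟩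
      rw [add_sub_cancel, sub_eq_add_neg]
      exact hm.symm
    · exact ⟨0, fun h => (h rfl).elim⟩
    · obtain ⟨m, hm⟩ := hy n hn
      exact ⟨m.natAbs, fun _ => ⟨m, by simp, by rwa [add_comm]⟩⟩
  choose l hl using h
  obtain ⟨L, hL⟩ := ((Set.finite_Icc (-N : ℤ) N).image l).bddAbove
  refine ⟨L, fun n hn hnN => ?_⟩
  obtain ⟨j, hj, hne⟩ := hl n hn
  exact ⟨j, hj.trans (by exact_mod_cast hL ⟨n, abs_le.1 hnN, rfl⟩), hne⟩

theorem finite_of_forall_family {α β : Type*} (f : α → β) (S : Set α) (k : ℕ)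
    (h : ∀ y : Fin k → α, (∀ i, y i ∈ S) → Function.Injective (f ∘ y) → False) :
    (f '' S).Finite := by
  by_contra hinf
  obtain ⟨T, hTS, hT⟩ := Set.Infinite.exists_subset_card_eq hinf k
  have e := T.equivFin.symm
  rw [hT] at e
  choose y hyS hy using fun i : Fin k => hTS (e i).2
  refine h y hyS fun i j hij => ?_
  simp only [Function.comp_apply, hy] at hij
  exact e.injective (Subtype.ext hij)

/-- Non-recurrence excludes returns from some time N on; aperiodicity excludes the finitely many
earlier positive times after enlarging the radius. -/
theorem exists_radius_of_mem_nonRecurrentPoints_atTop {A : Type*} [TopologicalSpace A]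
    {X : Subshift A ℤ} {y : X.carrier} (hy : y ∈ nonRecurrentPoints X Filter.atTop) :
    ∃ l : ℕ, ∀ n : ℤ, 0 < n → ∃ j : ℤ, |j| ≤ l ∧ y.1 (n + j) ≠ y.1 j := by
  have hnp := mem_aperiodicPoints_iff.1
    (nonRecurrentPoints_subset_aperiodicPoints X (Or.inl rfl) hy)
  change ¬ MapClusterPt y _ _ at hy
  rw [mapClusterPt_iff_frequently] at hy
  push Not at hy
  obtain ⟨U, hU, hev⟩ := hy
  obtain ⟨N, hN⟩ := Filter.eventually_atTop.1 hev
  obtain ⟨l, hl⟩ := exists_radius_of_mem_nhds hU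
  obtain ⟨l', hl'⟩ := hnp.exists_radius N.natAbs
  refine ⟨max l l', fun n hn => ?_⟩
  rcases le_or_gt N n with h | h
  · by_contra! hall
    refine hN n h (hl _ fun m hm => ?_)
    rw [shiftHomeo_zpow_apply]
    exact hall m (hm.trans (by simp))
  · obtain ⟨j, hj, hne⟩ := hl' n hn.ne' (by rw [abs_of_pos hn]; omega)
    exact ⟨j, hj.trans (by simp), hne⟩

theorem exists_radius_of_mem_nonRecurrentPoints_atBot {A : Type*} [TopologicalSpace A]
    {X : Subshift A ℤ} {y : X.carrier} (hy : y ∈ nonRecurrentPoints X Filter.atBot) :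
    ∃ l : ℕ, ∀ n : ℤ, n < 0 → ∃ j : ℤ, |j| ≤ l ∧ y.1 (n + j) ≠ y.1 j := by
  have hnp := mem_aperiodicPoints_iff.1
    (nonRecurrentPoints_subset_aperiodicPoints X (Or.inr rfl) hy)
  change ¬ MapClusterPt y _ _ at hy
  rw [mapClusterPt_iff_frequently] at hy
  push Not at hy
  obtain ⟨U, hU, hev⟩ := hy
  obtain ⟨N, hN⟩ := Filter.eventually_atBot.1 hev
  obtain ⟨l, hl⟩ := exists_radius_of_mem_nhds hU
  obtain ⟨l', hl'⟩ := hnp.exists_radius N.natAbs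
  refine ⟨max l l', fun n hn => ?_⟩
  rcases le_or_gt n N with h | h
  · by_contra! hall
    refine hN n h (hl _ fun m hm => ?_)
    rw [shiftHomeo_zpow_apply]
    exact hall m (hm.trans (by simp))
  · obtain ⟨j, hj, hne⟩ := hl' n hn.ne (by rw [abs_of_neg hn]; omega)
    exact ⟨j, hj.trans (by simp), hne⟩

theorem finite_orbits_nonRecurrentPoints {A : Type*} [Finite A] [TopologicalSpace A]
    {X : Subshift A ℤ} {k : ℕ}
    (hk : Filter.limsup (fun n : ℕ => (complexity X n : ENNReal) / (n : ENNReal)) Filter.atTop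
      < (k : ENNReal)) {F : Filter ℤ} (hF : F = Filter.atTop ∨ F = Filter.atBot) :
    (shiftOrbit X '' nonRecurrentPoints X F).Finite := by
  refine finite_of_forall_family _ _ k fun y hy hinj => lt_irrefl k (lt_of_family hk y ?_)
  have horb : ∀ i j, i ≠ j → ∀ a : ℤ, ∃ m, (y i).1 m ≠ (y j).1 (m - a) := fun i j hij =>
    exists_ne_of_shiftOrbit_ne (hinj.ne hij)
  rcases hF with rfl | rfl
  · choose l hl using fun i => exists_radius_of_mem_nonRecurrentPoints_atTop (hy i)
    obtain ⟨L, hL⟩ := (Set.finite_range l).bddAbove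
    refine mul_sub_le_ncard_of_not_return (fun i => (y i).1) (l := L) (fun i n hn => ?_) horb
    obtain ⟨j, hj, hne⟩ := hl i n hn
    exact ⟨j, hj.trans (by exact_mod_cast hL ⟨i, rfl⟩), hne⟩
  · choose l hl using fun i => exists_radius_of_mem_nonRecurrentPoints_atBot (hy i)
    obtain ⟨L, hL⟩ := (Set.finite_range l).bddAbove
    refine mul_sub_le_ncard_of_not_return_neg (fun i => (y i).1) (l := L) (fun i n hn => ?_) horb
    obtain ⟨j, hj, hne⟩ := hl i n hn
    exact ⟨j, hj.trans (by exact_mod_cast hL ⟨i, rfl⟩), hne⟩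

/-! ### Finitely many asymptotic orbits -/

/-- The left ray of `y` ending at time `0`. -/
def leftRay {A : Type*} [TopologicalSpace A] {X : Subshift A ℤ} (y : X.carrier) : ℕ → A :=
  fun n => y.1 (-n)

theorem leftRay_shift_eq {A : Type*} [TopologicalSpace A] {X : Subshift A ℤ} {y z : X.carrier}
    {s t : ℤ} (h : leftRay ((shiftHomeo X ^ s) y) = leftRay ((shiftHomeo X ^ t) z)) {m : ℤ}
    (hm : m ≤ 0) : y.1 (s + m) = z.1 (t + m) := by
  have := congrFun h (-m).toNat
  simp only [leftRay, shiftHomeo_zpow_apply, Int.toNat_of_nonneg (neg_nonneg.2 hm), neg_neg] at this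
  exact this

theorem BranchesAt.shift {A : Type*} [TopologicalSpace A] {X : Subshift A ℤ} {y : X.carrier}
    {t : ℤ} (h : BranchesAt y t) (s : ℤ) : BranchesAt ((shiftHomeo X ^ s) y) (t - s) := by
  obtain ⟨z, hz, hne⟩ := h
  refine ⟨(shiftHomeo X ^ s) z, fun m hm => ?_, ?_⟩
  · rw [shiftHomeo_zpow_apply, shiftHomeo_zpow_apply]
    exact hz _ (by omega)
  · rwa [shiftHomeo_zpow_apply, shiftHomeo_zpow_apply, add_sub_cancel]

/-- Take n with P(n+1) - P(n) < k, so large that 2k + 1 given rays differ on [-n, 0]. Branching at 0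
gives each of these words a partner with the same first n letters, but by `ncard_not_unique_le`
fewer than 2k words have one. -/
theorem finite_leftRay_branching {A : Type*} [Finite A] [TopologicalSpace A]
    {X : Subshift A ℤ} {k : ℕ}
    (hk : Filter.limsup (fun n : ℕ => (complexity X n : ENNReal) / (n : ENNReal)) Filter.atTop
      < (k : ENNReal)) : (leftRay '' {y : X.carrier | BranchesAt y 0}).Finite := by
  refine finite_of_forall_family _ _ (2 * k + 1) fun y hy hinj => ?_
  have hsep : ∀ p : Fin (2 * k + 1) × Fin (2 * k + 1), ∃ n : ℕ, p.1 ≠ p.2 →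
      (y p.1).1 (-n) ≠ (y p.2).1 (-n) := by
    intro p
    by_cases hp : p.1 = p.2
    · exact ⟨0, fun h => (h hp).elim⟩
    · obtain ⟨n, hn⟩ := Function.ne_iff.1 (hinj.ne hp)
      exact ⟨n, fun _ => hn⟩
  choose e he using hsep
  obtain ⟨L, hL⟩ := (Set.finite_range e).bddAbove
  obtain ⟨n, hn, hlt⟩ := exists_complexity_succ_lt hk L
  set f : (Fin (n + 1) → A) → (Fin n → A) := fun w => Fin.init w with hf
  have hcard := ncard_not_unique_le f (words X (n + 1))
  rw [image_init_words] at hcard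
  let v : Fin (2 * k + 1) → (Fin (n + 1) → A) := fun i => window (y i).1 (n + 1) (-n)
  have hv : Function.Injective v := by
    intro i j hij
    by_contra hne
    refine he (i, j) hne ?_
    have hle : e (i, j) ≤ n := (hL ⟨(i, j), rfl⟩).trans hn
    have := window_eq_iff.1 hij (n - e (i, j)) (by omega) (by push_cast; omega)
    convert this using 2 <;> ring
  have hsub : Set.range v ⊆ {a ∈ words X (n + 1) | ∃ b ∈ words X (n + 1), b ≠ a ∧ f b = f a} := by
    rintro _ ⟨i, rfl⟩
    obtain ⟨z, hz, hne⟩ := hy i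
    refine ⟨range_window_subset_words X _ _ ⟨_, rfl⟩, window z.1 (n + 1) (-n),
      range_window_subset_words X _ _ ⟨_, rfl⟩, fun h => hne ?_, funext fun a => ?_⟩
    · have := window_eq_iff.1 h n (by omega) (by push_cast; omega)
      simpa using this
    · have := a.2
      exact hz _ (by simp)
  have h1 := Set.ncard_le_ncard hsub (Set.toFinite _)
  rw [← Set.image_univ, Set.ncard_image_of_injective _ hv, Set.ncard_univ, Nat.card_fin] at h1
  have h2 := h1.trans hcard
  unfold complexity at hlt
  omega

/-- By finiteness, infinitely many of unboundedly late branching times share one left ray. Two of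
them make this ray periodic, and since it also ends at arbitrarily late times, y would be periodic.
-/
theorem bddAbove_branching {A : Type*} [Finite A] [TopologicalSpace A]
    {X : Subshift A ℤ} {k : ℕ}
    (hk : Filter.limsup (fun n : ℕ => (complexity X n : ENNReal) / (n : ENNReal)) Filter.atTop
      < (k : ENNReal)) {y : X.carrier} (hy : y ∈ aperiodicPoints X) :
    ∃ b, ∀ t, BranchesAt y t → t ≤ b := by
  by_contra! hunb
  choose t ht htlt using fun n : ℕ => hunb n
  have hfin := finite_leftRay_branching hk
  have := hfin.to_subtype
  let c : ℕ → (leftRay '' {y : X.carrier | BranchesAt y 0}) := fun n =>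
    ⟨leftRay ((shiftHomeo X ^ t n) y), _, by simpa using (ht n).shift (t n), rfl⟩
  obtain ⟨r, hr⟩ := Finite.exists_infinite_fiber c
  have hr' : (c ⁻¹' {r}).Infinite := Set.infinite_coe_iff.1 hr
  have heq : ∀ a ∈ c ⁻¹' {r}, ∀ b ∈ c ⁻¹' {r}, ∀ m : ℤ, m ≤ 0 →
      y.1 (t a + m) = y.1 (t b + m) := fun a ha b hb m hm =>
    leftRay_shift_eq (Subtype.ext_iff.1 (Eq.trans ha (Eq.symm hb))) hm
  obtain ⟨a, ha, -⟩ := hr'.exists_gt 0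
  obtain ⟨b, hb, hab⟩ := hr'.exists_gt (t a).natAbs
  have hlt : t a < t b := by
    have := htlt b
    omega
  obtain ⟨m, hm⟩ := mem_aperiodicPoints_iff.1 hy (t b - t a) (by omega)
  obtain ⟨d, hd, hmd⟩ := hr'.exists_gt (m + (t b - t a)).natAbs
  have htd := htlt d
  have h1 := heq d hd b hb (m + (t b - t a) - t d) (by omega)
  have h2 := heq d hd a ha (m - t d) (by omega)
  have h3 := heq d hd a ha (m + (t b - t a) - t d) (by omega)
  have h4 := heq b hb a ha (m - t d) (by omega)
  apply hm
  rw [show m + (t b - t a) = t d + (m + (t b - t a) - t d) by ring, h3,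
    show m = t d + (m - t d) by ring, h2, ← h4]
  exact congrArg y.1 (by ring)

theorem finite_orbits_asymptoticPoints {A : Type*} [Finite A] [TopologicalSpace A]
    {X : Subshift A ℤ} {k : ℕ}
    (hk : Filter.limsup (fun n : ℕ => (complexity X n : ENNReal) / (n : ENNReal)) Filter.atTop
      < (k : ENNReal)) : (shiftOrbit X '' asymptoticPoints X).Finite := by
  -- Each orbit in question contains a point whose last branching time is 0. Such a point is
  -- determined by its left ray, because a first disagreement after 0 would be a later branching.
  set S : Set X.carrier := {y | BranchesAt y 0 ∧ ∀ t, BranchesAt y t → t ≤ 0} with hS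
  have hinj : Set.InjOn leftRay S := by
    rintro y ⟨-, hy⟩ z - hyz
    by_contra hne
    have heq : ∀ m : ℤ, m ≤ 0 → y.1 m = z.1 m := by
      intro m hm
      have := leftRay_shift_eq (s := 0) (t := 0) (by simpa using hyz) hm
      simpa using this
    have hex : ∃ m, z.1 m ≠ y.1 m := by
      by_contra! hall
      exact hne (Subtype.ext (funext fun m => (hall m).symm))
    obtain ⟨s, hs, hmin⟩ := Int.exists_least_of_bdd (P := fun m => z.1 m ≠ y.1 m)
      ⟨0, fun m hm => by
        by_contra! hlt
        exact hm (heq m hlt.le).symm⟩ hex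
    have hs0 := hy s ⟨z, fun m hm => by
      by_contra hm'
      have := hmin m hm'
      omega, hs⟩
    exact hs (heq s hs0).symm
  have hSfin : S.Finite := Set.Finite.of_finite_image
    ((finite_leftRay_branching hk).subset (Set.image_mono fun y hy => hy.1)) hinj
  refine (hSfin.image (shiftOrbit X)).subset ?_
  rintro _ ⟨y, ⟨hy, hex⟩, rfl⟩
  obtain ⟨t, ht, hmax⟩ := Int.exists_greatest_of_bdd (bddAbove_branching hk hy) hex
  refine ⟨(shiftHomeo X ^ t) y, ⟨by simpa using ht.shift t, fun s hs => ?_⟩,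
    shiftOrbit_eq_of_mem ⟨t, rfl⟩⟩
  have := hs.shift (-t)
  rw [← Homeomorph.mul_apply, ← zpow_add, neg_add_cancel, zpow_zero] at this
  have := hmax _ this
  omega

/-! ### Special orbits near every aperiodic point -/

/-- An automorphism-invariant set of aperiodic points that, under linear complexity, consists of
finitely many orbits. -/
def specialPoints {A : Type*} [TopologicalSpace A] (X : Subshift A ℤ) : Set X.carrier :=
  nonRecurrentPoints X Filter.atTop ∪ nonRecurrentPoints X Filter.atBot ∪ asymptoticPoints X

theorem specialPoints_subset_aperiodicPoints {A : Type*} [TopologicalSpace A] (X : Subshift A ℤ) :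
    specialPoints X ⊆ aperiodicPoints X :=
  Set.union_subset (Set.union_subset
    (nonRecurrentPoints_subset_aperiodicPoints X (Or.inl rfl))
    (nonRecurrentPoints_subset_aperiodicPoints X (Or.inr rfl))) fun _ h => h.1

theorem specialPoints_image {A : Type*} [Finite A] [TopologicalSpace A] [DiscreteTopology A]
    {X : Subshift A ℤ} {φ : X.carrier ≃ₜ X.carrier} (hφ : φ ∈ shiftAut X) {y : X.carrier}
    (h : y ∈ specialPoints X) : φ y ∈ specialPoints X := by
  rcases h with (h | h) | h
  · exact Or.inl (Or.inl (nonRecurrentPoints_image hφ h))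
  · exact Or.inl (Or.inr (nonRecurrentPoints_image hφ h))
  · exact Or.inr (asymptoticPoints_image hφ h)

theorem finite_orbits_specialPoints {A : Type*} [Finite A] [TopologicalSpace A]
    {X : Subshift A ℤ} {k : ℕ}
    (hk : Filter.limsup (fun n : ℕ => (complexity X n : ENNReal) / (n : ENNReal)) Filter.atTop
      < (k : ENNReal)) : (shiftOrbit X '' specialPoints X).Finite := by
  rw [specialPoints, Set.image_union, Set.image_union]
  exact ((finite_orbits_nonRecurrentPoints hk (Or.inl rfl)).union
    (finite_orbits_nonRecurrentPoints hk (Or.inr rfl))).union (finite_orbits_asymptoticPoints hk)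

theorem continuous_shiftHomeo_zpow {A : Type*} [TopologicalSpace A] (X : Subshift A ℤ) (n : ℤ) :
    Continuous fun x : X.carrier => (shiftHomeo X ^ n) x := (shiftHomeo X ^ n).continuous

/-- A point that enters `V` with bounded gaps has, near its orbit, an asymptotic pair. -/
theorem exists_asymptotic_of_syndetic {A : Type*} [Finite A] [TopologicalSpace A]
    [DiscreteTopology A] {X : Subshift A ℤ} {x : X.carrier} (hx : x ∈ aperiodicPoints X)
    {V : Set X.carrier} (hV : IsClosed V) {g : ℕ}
    (hg : ∀ s : ℤ, ∃ r ∈ Set.Ico (0 : ℤ) g, (shiftHomeo X ^ (s + r)) x ∈ V) :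
    ∃ y ∈ asymptoticPoints X, ∃ n : ℤ, (shiftHomeo X ^ n) y ∈ V := by
  -- The uniform gap g makes visiting V a closed condition, so limits of points in the orbit of x
  -- still visit V.
  set Y : Set X.carrier := {y | ∀ s : ℤ, ∃ r ∈ Set.Ico (0 : ℤ) g, (shiftHomeo X ^ (s + r)) y ∈ V}
    with hY
  have hYc : IsClosed Y := by
    have : Y = ⋂ s : ℤ, ⋃ r ∈ Set.Ico (0 : ℤ) g, {y | (shiftHomeo X ^ (s + r)) y ∈ V} := by
      ext y
      simp [hY]
    rw [this]
    exact isClosed_iInter fun s => (Set.finite_Ico _ _).isClosed_biUnion fun r _ =>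
      hV.preimage (continuous_shiftHomeo_zpow X _)
  have hYs : ∀ n : ℤ, (shiftHomeo X ^ n) x ∈ Y := by
    intro n s
    obtain ⟨r, hr, hrV⟩ := hg (s + n)
    refine ⟨r, hr, ?_⟩
    rw [← Homeomorph.mul_apply, ← zpow_add]
    rwa [show s + r + n = s + n + r by ring]
  have hcont := continuous_coordinate X
  obtain ⟨⟨y, z⟩, hyz⟩ := exists_forall_mem_of_antitone
    (K := fun n : ℕ => Y ×ˢ Y ∩ ({p : X.carrier × X.carrier |
      ∀ m : ℤ, -n ≤ m → m < 0 → p.1.1 m = p.2.1 m} ∩ {p | p.1.1 0 ≠ p.2.1 0}))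
    (fun a b hab p hp => ⟨hp.1, fun m hm => hp.2.1 m (by omega), hp.2.2⟩)
    (fun n => by
      refine (hYc.prod hYc).inter (IsClosed.inter ?_ ?_)
      · simp only [Set.ofPred_forall]
        exact isClosed_iInter fun m => isClosed_iInter fun _ => isClosed_iInter fun _ =>
          isClosed_eq ((hcont m).comp continuous_fst) ((hcont m).comp continuous_snd)
      · exact (isClosed_discrete {q : A × A | q.1 ≠ q.2}).preimage
          (((hcont 0).comp continuous_fst).prodMk ((hcont 0).comp continuous_snd)))
    -- A branching in x, moved to time 0, gives two points of its orbit that agree on [-n, 0) and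
    -- differ at 0.
    (fun n => by
      obtain ⟨s, t, hst, hne⟩ := (mem_aperiodicPoints_iff.1 hx).exists_branch n
      refine ⟨((shiftHomeo X ^ (s + n)) x, (shiftHomeo X ^ (t + n)) x), ⟨hYs _, hYs _⟩,
        fun m h1 h2 => ?_, ?_⟩
      · rw [shiftHomeo_zpow_apply, shiftHomeo_zpow_apply, add_assoc, add_assoc]
        exact window_eq_iff.1 hst (n + m) (by omega) (by omega)
      · change ((shiftHomeo X ^ (s + n)) x).1 0 ≠ ((shiftHomeo X ^ (t + n)) x).1 0
        rwa [shiftHomeo_zpow_apply, shiftHomeo_zpow_apply, add_zero, add_zero])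
  have heq : ∀ m < 0, y.1 m = z.1 m := fun m hm => (hyz m.natAbs).2.1 m (by omega) hm
  have hne : y.1 0 ≠ z.1 0 := (hyz 0).2.2
  have hY' : y ∈ Y ∧ z ∈ Y := (hyz 0).1
  have hvisit : ∀ v ∈ Y, ∃ n : ℤ, (shiftHomeo X ^ n) v ∈ V := fun v hv => by
    obtain ⟨r, -, hr⟩ := hv 0
    exact ⟨_, hr⟩
  by_cases hy : y ∈ aperiodicPoints X
  · exact ⟨y, ⟨hy, 0, z, fun m hm => (heq m hm).symm, hne.symm⟩, hvisit y hY'.1⟩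
  by_cases hz : z ∈ aperiodicPoints X
  · exact ⟨z, ⟨hz, 0, y, heq, hne⟩, hvisit z hY'.2⟩
  -- Two periodic points have the common period pq, so agreement on a left half-line forces
  -- agreement at 0.
  exfalso
  rw [mem_aperiodicPoints_iff, NoPeriod] at hy hz
  push Not at hy hz
  obtain ⟨p, hp, hpy⟩ := hy
  obtain ⟨q, hq, hqz⟩ := hz
  apply hne
  have h1 := Function.Periodic.int_mul (f := y.1) (c := p) hpy q (-(q * p))
  have h2 := Function.Periodic.int_mul (f := z.1) (c := q) hqz p (-(q * p))
  rw [Int.cast_id, neg_add_cancel] at h1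
  rw [Int.cast_id, mul_comm p q, neg_add_cancel] at h2
  rw [h1, h2]
  exact heq _ (neg_neg_of_pos (mul_pos hq hp))

/-- Long gaps have endpoints in V on the orbit of x that avoid V for g steps in one direction. One
direction works for every g, and compactness gives a point of V that never returns to V in that
direction. -/
theorem exists_nonRecurrent_of_gaps {A : Type*} [Finite A] [TopologicalSpace A]
    {X : Subshift A ℤ} {x : X.carrier} {V : Set X.carrier} (hV : IsClopen V) (hxV : x ∈ V)
    (hgap : ∀ g : ℕ, ∃ s : ℤ, ∀ r ∈ Set.Ico (0 : ℤ) g, (shiftHomeo X ^ (s + r)) x ∉ V) :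
    ∃ y ∈ nonRecurrentPoints X Filter.atTop ∪ nonRecurrentPoints X Filter.atBot, y ∈ V := by
  set P : ℤ → ℕ → Set X.carrier := fun ε g =>
    {y | y ∈ V ∧ ∀ d : ℤ, 0 < d → d < g → (shiftHomeo X ^ (ε * d)) y ∉ V} with hP
  have hanti : ∀ ε, Antitone (P ε) := fun ε a b hab y hy =>
    ⟨hy.1, fun d hd hda => hy.2 d hd (by omega)⟩
  have hclosed : ∀ ε g, IsClosed (P ε g) := fun ε g => by
    refine hV.isClosed.inter ?_
    change IsClosed {y | ∀ d : ℤ, 0 < d → d < g → (shiftHomeo X ^ (ε * d)) y ∉ V}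
    simp only [Set.ofPred_forall]
    exact isClosed_iInter fun d => isClosed_iInter fun _ => isClosed_iInter fun _ =>
      hV.compl.isClosed.preimage (continuous_shiftHomeo_zpow X _)
  have hne : ∀ g, (P 1 g).Nonempty ∨ (P (-1) g).Nonempty := by
    intro g
    obtain ⟨s, hs⟩ := hgap g
    obtain ⟨b, hb, h | h⟩ := Int.exists_gap (O := {t | (shiftHomeo X ^ t) x ∈ V}) (s := s)
      (e := s + g) (by simpa using hxV) (fun t h1 h2 => by
        simpa using hs (t - s) ⟨by omega, by omega⟩)
    · refine Or.inl ⟨(shiftHomeo X ^ b) x, hb, fun d hd hdg => ?_⟩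
      rw [← Homeomorph.mul_apply, ← zpow_add, one_mul, add_comm]
      exact h d hd (by omega)
    · refine Or.inr ⟨(shiftHomeo X ^ b) x, hb, fun d hd hdg => ?_⟩
      rw [← Homeomorph.mul_apply, ← zpow_add, neg_one_mul, neg_add_eq_sub]
      exact h d hd (by omega)
  by_cases h1 : ∀ g, (P 1 g).Nonempty
  · obtain ⟨y, hy⟩ := exists_forall_mem_of_antitone (hanti 1) (hclosed 1) h1
    refine ⟨y, Or.inl ?_, (hy 0).1⟩
    change ¬ MapClusterPt _ _ _
    rw [mapClusterPt_iff_frequently]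
    push Not
    refine ⟨V, hV.isOpen.mem_nhds (hy 0).1, ?_⟩
    filter_upwards [Filter.eventually_gt_atTop 0] with n hn
    simpa using (hy (n.toNat + 1)).2 n hn (by omega)
  · push Not at h1
    obtain ⟨g₀, hg₀⟩ := h1
    -- Forward gaps of length g₀ do not exist, so every gap of length max g g₀ must be a backward
    -- one.
    have h2 : ∀ g, (P (-1) g).Nonempty := by
      intro g
      rcases hne (max g g₀) with h | h
      · exact absurd (h.mono (hanti 1 (le_max_right g g₀))) (by simp [hg₀])
      · exact h.mono (hanti (-1) (le_max_left g g₀))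
    obtain ⟨y, hy⟩ := exists_forall_mem_of_antitone (hanti (-1)) (hclosed (-1)) h2
    refine ⟨y, Or.inr ?_, (hy 0).1⟩
    change ¬ MapClusterPt _ _ _
    rw [mapClusterPt_iff_frequently]
    push Not
    refine ⟨V, hV.isOpen.mem_nhds (hy 0).1, ?_⟩
    filter_upwards [Filter.eventually_lt_atBot 0] with n hn
    simpa using (hy (n.natAbs + 1)).2 (-n) (by omega) (by omega)

theorem exists_specialPoints_visiting {A : Type*} [Finite A] [TopologicalSpace A]
    [DiscreteTopology A] {X : Subshift A ℤ} {x : X.carrier} (hx : x ∈ aperiodicPoints X)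
    {V : Set X.carrier} (hV : IsClopen V) (hxV : x ∈ V) :
    ∃ y ∈ specialPoints X, ∃ n : ℤ, (shiftHomeo X ^ n) y ∈ V := by
  by_cases hs : ∃ g : ℕ, ∀ s : ℤ, ∃ r ∈ Set.Ico (0 : ℤ) g, (shiftHomeo X ^ (s + r)) x ∈ V
  · obtain ⟨g, hg⟩ := hs
    obtain ⟨y, hy, h⟩ := exists_asymptotic_of_syndetic hx hV.isClosed hg
    exact ⟨y, Or.inr hy, h⟩
  · push Not at hs
    obtain ⟨y, hy, h⟩ := exists_nonRecurrent_of_gaps hV hxV hs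
    exact ⟨y, Or.inl hy, 0, by simpa using h⟩

/-! ### Dense special orbits and the finite quotient -/

theorem exists_family_dense_orbits {A : Type*} [Finite A] [TopologicalSpace A]
    [DiscreteTopology A] {X : Subshift A ℤ} {k : ℕ}
    (hk : Filter.limsup (fun n : ℕ => (complexity X n : ENNReal) / (n : ENNReal)) Filter.atTop
      < (k : ENNReal)) (hX : Dense (aperiodicPoints X)) :
    ∃ (M : ℕ) (y : Fin M → X.carrier), (∀ i, y i ∈ specialPoints X) ∧
      Dense (⋃ i, shiftOrbit X (y i)) := by
  have hfin := finite_orbits_specialPoints hk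
  have := hfin.fintype
  choose r hr hrO using fun o : (shiftOrbit X '' specialPoints X) => o.2
  let e := (Fintype.equivFin (shiftOrbit X '' specialPoints X)).symm
  refine ⟨_, fun i => r (e i), fun i => hr _, ?_⟩
  rw [dense_iff_inter_open]
  intro U hU hne
  obtain ⟨x, hxU, hx⟩ := hX.inter_open_nonempty U hU hne
  obtain ⟨l, hl⟩ := exists_radius_of_mem_nhds (hU.mem_nhds hxU)
  obtain ⟨y, hy, n, hn⟩ := exists_specialPoints_visiting hx (isClopen_radius x l)
    (fun m _ => rfl)
  refine ⟨_, hl _ hn, Set.mem_iUnion.2 ⟨e.symm ⟨_, y, hy, rfl⟩, ?_⟩⟩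
  rw [hrO, Equiv.apply_symm_apply]
  exact ⟨n, rfl⟩

/-- On the orbit of y i the map φ is one fixed power of the shift, hence also on its closure;
finitely many such closures cover X. -/
theorem mem_fullGroup_of_dense {A : Type*} [TopologicalSpace A] [T2Space A]
    {X : Subshift A ℤ} {M : ℕ} {y : Fin M → X.carrier} (hd : Dense (⋃ i, shiftOrbit X (y i)))
    {φ : X.carrier ≃ₜ X.carrier} (hφ : φ ∈ shiftAut X) (h : ∀ i, φ (y i) ∈ shiftOrbit X (y i)) :
    φ ∈ fullGroup X := by
  intro x
  have hx := hd x
  rw [closure_iUnion_of_finite] at hx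
  obtain ⟨i, hi⟩ := Set.mem_iUnion.1 hx
  obtain ⟨n, hn⟩ := h i
  refine ⟨n, closure_minimal (t := {x | φ x = (shiftHomeo X ^ n) x}) ?_
    (isClosed_eq φ.continuous (continuous_shiftHomeo_zpow X n)) hi⟩
  rintro _ ⟨m, rfl⟩
  change φ _ = _
  rw [shiftAut_apply_zpow hφ, hn, ← Homeomorph.mul_apply, ← Homeomorph.mul_apply,
    (Commute.refl (shiftHomeo X)).zpow_zpow m n |>.eq]

/-- An automorphism is recorded by the special orbits to which it sends the orbits of the y i. There
are finitely many records, and automorphisms with equal records lie in one coset. -/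
theorem finite_quotient_fullGroup {A : Type*} [Finite A] [TopologicalSpace A]
    [DiscreteTopology A] {X : Subshift A ℤ} {k : ℕ}
    (hk : Filter.limsup (fun n : ℕ => (complexity X n : ENNReal) / (n : ENNReal)) Filter.atTop
      < (k : ENNReal)) (hX : Dense (aperiodicPoints X)) :
    Finite (shiftAut X ⧸ (fullGroup X).subgroupOf (shiftAut X)) := by
  obtain ⟨M, y, hy, hd⟩ := exists_family_dense_orbits hk hX
  have := (finite_orbits_specialPoints hk).to_subtype
  let f : shiftAut X → Fin M → (shiftOrbit X '' specialPoints X) := fun φ i =>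
    ⟨shiftOrbit X (φ.1 (y i)), _, specialPoints_image φ.2 (hy i), rfl⟩
  have key : ∀ φ ψ, f φ = f ψ → φ⁻¹ * ψ ∈ (fullGroup X).subgroupOf (shiftAut X) := by
    intro φ ψ h
    rw [Subgroup.mem_subgroupOf]
    refine mem_fullGroup_of_dense hd (φ⁻¹ * ψ).2 fun i => ?_
    have hi : shiftOrbit X (φ.1 (y i)) = shiftOrbit X (ψ.1 (y i)) :=
      Subtype.ext_iff.1 (congrFun h i)
    have h1 : ψ.1 (y i) ∈ shiftOrbit X (φ.1 (y i)) := hi ▸ mem_shiftOrbit_self _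
    have h2 := shiftOrbit_image (φ⁻¹).2 h1
    have h3 : (φ⁻¹).1 (φ.1 (y i)) = y i := φ.1.symm_apply_apply (y i)
    rw [h3] at h2
    exact h2
  refine Finite.of_injective (fun q : shiftAut X ⧸ (fullGroup X).subgroupOf (shiftAut X) =>
    f q.out) fun p q h => ?_
  rw [← p.out_eq', ← q.out_eq']
  exact QuotientGroup.eq.2 (key _ _ h)

/-! ### Fewer than k dense orbits and the rank -/

theorem exists_family_lt_dense_orbits {A : Type*} [Finite A] [TopologicalSpace A]
    [DiscreteTopology A] {X : Subshift A ℤ} {k : ℕ}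
    (hk : Filter.limsup (fun n : ℕ => (complexity X n : ENNReal) / (n : ENNReal)) Filter.atTop
      < (k : ENNReal)) (hX : Dense (aperiodicPoints X)) :
    ∃ M < k, ∃ y : Fin M → X.carrier, (∀ i, y i ∈ aperiodicPoints X) ∧
      Dense (⋃ i, shiftOrbit X (y i)) := by
  classical
  have hex : ∃ (M : ℕ) (y : Fin M → X.carrier), (∀ i, y i ∈ aperiodicPoints X) ∧
      Dense (⋃ i, shiftOrbit X (y i)) := by
    obtain ⟨M, y, hy, hd⟩ := exists_family_dense_orbits hk hX
    exact ⟨M, y, fun i => specialPoints_subset_aperiodicPoints X (hy i), hd⟩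
  obtain ⟨y, hy, hd⟩ := Nat.find_spec hex
  refine ⟨Nat.find hex, lt_of_family hk y ?_, y, hy, hd⟩
  have hmin := fun m => Nat.find_min hex (m := m)
  generalize Nat.find hex = M at y hmin
  have hrad : ∀ i, ∃ l : ℕ, ∀ j, i ≠ j → ∀ t : ℤ, ∃ m : ℤ, |m| ≤ l ∧
      (y j).1 (t + m) ≠ (y i).1 m := by
    intro i
    obtain ⟨M, rfl⟩ : ∃ N, M = N + 1 := ⟨M - 1, by have := i.pos; omega⟩
    -- By minimality the other orbits miss an open set U, which the orbit of y i must then visit; a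
    -- central pattern of y i that forces this visit occurs in no other y j.
    have hnd : ¬ Dense (⋃ j, shiftOrbit X (y (i.succAbove j))) := fun h =>
      hmin M M.lt_succ_self ⟨fun j => y (i.succAbove j), fun j => hy _, h⟩
    rw [dense_iff_inter_open] at hnd
    push Not at hnd
    obtain ⟨U, hU, hne, hdisj⟩ := hnd
    obtain ⟨z, hzU, hz⟩ := hd.inter_open_nonempty U hU hne
    have hmiss : ∀ j, j ≠ i → ∀ n : ℤ, (shiftHomeo X ^ n) (y j) ∉ U := by
      intro j hj n hn
      obtain ⟨j', rfl⟩ := Fin.exists_succAbove_eq hj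
      exact Set.eq_empty_iff_forall_notMem.1 hdisj _ ⟨hn, Set.mem_iUnion.2 ⟨j', n, rfl⟩⟩
    obtain ⟨i', n, rfl⟩ := Set.mem_iUnion.1 hz
    obtain rfl : i' = i := by
      by_contra hne'
      exact hmiss i' hne' n hzU
    obtain ⟨l, hl⟩ := exists_radius_of_mem_nhds
      ((hU.preimage (continuous_shiftHomeo_zpow X n)).mem_nhds hzU)
    refine ⟨l, fun j hj t => ?_⟩
    by_contra! hall
    have := hl ((shiftHomeo X ^ t) (y j)) fun m hm => by
      rw [shiftHomeo_zpow_apply, hall m hm]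
    rw [Set.mem_preimage, ← Homeomorph.mul_apply, ← zpow_add] at this
    exact hmiss j hj.symm _ this
  choose l hl using hrad
  obtain ⟨L, hL⟩ := (Set.finite_range l).bddAbove
  refine mul_sub_le_ncard_of_independent (fun i => (y i).1)
    (fun i => mem_aperiodicPoints_iff.1 (hy i)) (l := L) fun i j hij t => ?_
  obtain ⟨m, hm, hne⟩ := hl i j hij t
  exact ⟨m, hm.trans (by exact_mod_cast hL ⟨i, rfl⟩), hne⟩

theorem zpow_eq_of_mem_aperiodicPoints {A : Type*} [TopologicalSpace A] {X : Subshift A ℤ}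
    {y : X.carrier} (hy : y ∈ aperiodicPoints X) {m n : ℤ}
    (h : (shiftHomeo X ^ m) y = (shiftHomeo X ^ n) y) : m = n := by
  rw [mem_aperiodicPoints_iff] at hy
  by_contra hne
  wlog hlt : m < n generalizing m n with H
  · exact H h.symm (Ne.symm hne) (by omega)
  obtain ⟨a, ha⟩ := hy (n - m) (by omega)
  apply ha
  have := congrArg (fun z : X.carrier => z.1 (a - m)) h
  simp only [shiftHomeo_zpow_apply, add_sub_cancel] at this
  rw [this]
  exact congrArg y.1 (by ring)

theorem exists_mulEquiv_of_injective {G : Type*} [Group G] {M : ℕ}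
    (f : G →* Multiplicative (Fin M → ℤ)) (hf : Function.Injective f) :
    ∃ d ≤ M, Nonempty (G ≃* Multiplicative (Fin d → ℤ)) := by
  let S : Submodule ℤ (Fin M → ℤ) := AddSubgroup.toIntSubmodule (MonoidHom.toAdditiveLeft f).range
  let e₁ : Additive G ≃+ (MonoidHom.toAdditiveLeft f).range := AddMonoidHom.ofInjective hf
  let e₂ : S ≃+ (Fin (Module.finrank ℤ S) → ℤ) :=
    (Module.finBasis ℤ S).equivFun.toAddEquiv
  refine ⟨Module.finrank ℤ S, ?_, ⟨AddEquiv.toMultiplicativeRight (e₁.trans e₂)⟩⟩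
  simpa using Submodule.finrank_le S

/-- The exponents n i with φ (y i) = σ^(n i) (y i) are unique by aperiodicity and additive because φ
commutes with σ; they determine φ on a dense set. -/
theorem exists_injective_fullGroup {A : Type*} [TopologicalSpace A] [T2Space A]
    {X : Subshift A ℤ} {M : ℕ} {y : Fin M → X.carrier} (hy : ∀ i, y i ∈ aperiodicPoints X)
    (hd : Dense (⋃ i, shiftOrbit X (y i))) :
    ∃ f : ↥(shiftAut X ⊓ fullGroup X) →* Multiplicative (Fin M → ℤ), Function.Injective f := by
  choose n hn using fun (φ : ↥(shiftAut X ⊓ fullGroup X)) i => φ.2.2 (y i)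
  have hmul : ∀ φ ψ, n (φ * ψ) = n φ + n ψ := by
    intro φ ψ
    funext i
    apply zpow_eq_of_mem_aperiodicPoints (hy i)
    rw [← hn, Pi.add_apply, add_comm, zpow_add, Homeomorph.mul_apply, ← hn,
      ← shiftAut_apply_zpow φ.2.1, ← hn]
    rfl
  refine ⟨MonoidHom.mk' (fun φ => Multiplicative.ofAdd (n φ)) fun φ ψ => by
    rw [hmul, ofAdd_add], fun φ ψ h => ?_⟩
  have h' : n φ = n ψ := h
  apply Subtype.ext
  apply Homeomorph.ext
  refine congrFun (Continuous.ext_on hd φ.1.continuous ψ.1.continuous ?_)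
  intro x hx
  obtain ⟨i, m, rfl⟩ := Set.mem_iUnion.1 hx
  rw [shiftAut_apply_zpow φ.2.1, shiftAut_apply_zpow ψ.2.1, hn, hn, h']

theorem normal_fullGroup_subgroupOf {A : Type*} [TopologicalSpace A] (X : Subshift A ℤ) :
    ((fullGroup X).subgroupOf (shiftAut X)).Normal := by
  refine ⟨fun ψ hψ φ => ?_⟩
  rw [Subgroup.mem_subgroupOf] at hψ ⊢
  intro x
  have h := shiftOrbit_image φ.2 (hψ (φ.1.symm x))
  rw [Homeomorph.apply_symm_apply] at h
  exact h

theorem theorem2 {A : Type*} [Finite A] [TopologicalSpace A] [DiscreteTopology A]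
    (X : SymbolicDynamics.FullShift.Subshift A ℤ) (k : ℕ)
    (hk : Filter.limsup (fun n : ℕ => (complexity X n : ENNReal) / (n : ENNReal)) Filter.atTop
      < (k : ENNReal))
    (hX : Dense (aperiodicPoints X)) :
    ((fullGroup X).subgroupOf (shiftAut X)).Normal ∧
    Finite (shiftAut X ⧸ (fullGroup X).subgroupOf (shiftAut X)) ∧
    ∃ d : ℕ, d < k ∧
      Nonempty (↥(shiftAut X ⊓ fullGroup X) ≃* Multiplicative (Fin d → ℤ)) ∧
      IsVirtually (shiftAut X) (Multiplicative (Fin d → ℤ)) := by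
  have hfin := finite_quotient_fullGroup hk hX
  obtain ⟨M, hM, y, hy, hd⟩ := exists_family_lt_dense_orbits hk hX
  obtain ⟨f, hf⟩ := exists_injective_fullGroup hy hd
  obtain ⟨d, hdM, ⟨e⟩⟩ := exists_mulEquiv_of_injective f hf
  refine ⟨normal_fullGroup_subgroupOf X, hfin, d, hdM.trans_lt hM, ⟨e⟩,
    (fullGroup X).subgroupOf (shiftAut X), Subgroup.finiteIndex_of_finite_quotient, ⟨?_⟩⟩
  rw [← Subgroup.inf_subgroupOf_left]
  exact (Subgroup.subgroupOfEquivOfLe inf_le_left).trans e
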